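/- Let $(X,d)$ be a separable metric space, not necessarily complete, and let $\mathfrak m$ be a nonzero Radon measure on $X$ that is finite on bounded sets. Let $1\le p<\infty$. Write $B_r(x)$ for open balls. For $u:X\to\mathbb R$ let $$\operatorname{lip}u(x)=\inf_{\varepsilon>0}\ \sup_{y\in B_\varepsilon(x)\setminus\{x\}}\frac{|u(y)-u(x)|}{d(y,x)}$$ (with $\sup\emptyset=0$) be its local Lipschitz constant. For $\varepsilon>0$, a Borel function $g:X\to[0,\infty]$ is an $\varepsilon$-upper gradient of $u$ if $$|u(q_N)-u(q_0)|\le\sum_{i=0}^{N-1}\frac{g(q_i)+g(q_{i+1})}{2}\,d(q_i,q_{i+1})$$ for all finite sequences $q_0,\dots,q_N$ in $X$ with $d(q_i,q_{i+1})\le\varepsilon$ for every $i<N$. For constants $C,\lambda\ge1$, a couple $(u,g)$ with $u:X\to\mathbb R$ and $g:X\to[0,\infty]$ Borel satisfies the $p$-Poincaré inequality with constants $C,\lambda$ if for all $x\in X$ and $r>0$ $$\frac1{\mathfrak m(B_r(x))}\int_{B_r(x)}|u-u_{B_r(x)}|\,d\mathfrak m\le C\,r\left(\frac1{\mathfrak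 m(B_{\lambda r}(x))}\int_{B_{\lambda r}(x)}g^p\,d\mathfrak m\right)^{1/p},\qquad u_{B_r(x)}=\frac1{\mathfrak m(B_r(x))}\int_{B_r(x)}u\,d\mathfrak m,$$ where there is no condition on balls of measure zero, and the left-hand side is $\infty$ if $u$ is not integrable on $B_r(x)$. Let $(\bar X,\bar d)$ be the metric completion of $(X,d)$, with the measure $\bar{\mathfrak m}(E)=\mathfrak m(E\cap X)$. Then for all $C,\lambda\ge1$ the following are equivalent. (a) All couples $(u,\operatorname{lip}u)$ with $u:X\to\mathbb R$ Lipschitz satisfy the $p$-Poincaré inequality in $(X,d,\mathfrak m)$ with constants $C,\lambda$. (b) All couples $(u,g)$, with $u:X\to\mathbb R$ Borel and $g$ an $\varepsilon$-upper gradient of $u$ for some $\varepsilon>0$, satisfy the $p$-Poincaré inequality in $(X,d,\mathfrak m)$ with constants $C,\lambda$. (c) All couples $(u,\operatorname{lip}u)$ with $u:\bar X\to\mathbb R$ Lipschitz satisfy the $p$-Poincaré inequality in $(\bar X,\bar d,\bar{\mathfrak m})$ with constants $C,\lambda$. -/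

import Mathlib

open MeasureTheory Metric
open scoped ENNReal

noncomputable section

namespace ChainPoincare

/-- The slope of `u` at `x` at scale `ε`: the supremum of `|u y - u x| / d(y, x)` over the points
`y` of the open ball `B_ε(x)`. The term `y = x` is `0 / 0 = 0`, so it does not contribute. -/
def slopeAt {X : Type*} [MetricSpace X] (ε : ℝ) (u : X → ℝ) (x : X) : ℝ≥0∞ :=
  ⨆ y ∈ ball x ε, edist (u y) (u x) / edist y x

/-- The local Lipschitz constant `lip u (x) = inf_{ε > 0} slope_ε u (x)`. -/
def lip {X : Type*} [MetricSpace X] (u : X → ℝ) (x : X) : ℝ≥0∞ :=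
  ⨅ (ε : ℝ) (_ : 0 < ε), slopeAt ε u x

/-- The finite sequence `q 0, …, q N` is an `ε`-chain: consecutive points have distance `≤ ε`. -/
def IsEpsChain {X : Type*} [MetricSpace X] (ε : ℝ) {N : ℕ} (q : Fin (N + 1) → X) : Prop :=
  ∀ i : Fin N, dist (q i.castSucc) (q i.succ) ≤ ε

/-- The integral of `g` along the chain `q 0, …, q N`:
`∑_{i < N} (g (q i) + g (q (i + 1))) / 2 * d(q i, q (i + 1))`. -/
def chainIntegral {X : Type*} [MetricSpace X] (g : X → ℝ≥0∞) {N : ℕ} (q : Fin (N + 1) → X) :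
    ℝ≥0∞ :=
  ∑ i : Fin N, (g (q i.castSucc) + g (q i.succ)) / 2 * edist (q i.castSucc) (q i.succ)

/-- `g` is an `ε`-upper gradient of `u`: it is a Borel function with values in `[0, ∞]`, and
`|u (q N) - u (q 0)|` is at most the integral of `g` along `q` for every `ε`-chain `q`. -/
def IsEpsUpperGradient {X : Type*} [MetricSpace X] [MeasurableSpace X] (ε : ℝ)
    (u : X → ℝ) (g : X → ℝ≥0∞) : Prop :=
  Measurable g ∧
    ∀ (N : ℕ) (q : Fin (N + 1) → X), IsEpsChain ε q →
      ENNReal.ofReal |u (q (Fin.last N)) - u (q 0)| ≤ chainIntegral g q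

/-- The `p`-Poincaré inequality for the couple `(u, g)` with constants `C` and `Λ`, on every open
ball `B_r(x)`, `r > 0`, as an inequality in `[0, ∞]`:
`⨍_{B_r(x)} |u - ⨍_{B_r(x)} u| ≤ C r (⨍_{B_{Λ r}(x)} g ^ p) ^ (1 / p)`.
The outer average is a Lebesgue integral with values in `[0, ∞]`. If a Borel function `u` is not
integrable on the ball, then the inner Bochner average is `0` and the left-hand side is `∞`; so the
inequality contains the integrability of `u` on the ball whenever the right-hand side is finite.
If the ball is a null set, then the left-hand side is `0`. -/
def PoincareCouple {X : Type*} [MetricSpace X] [MeasurableSpace X] (μ : Measure X)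
    (p C Λ : ℝ) (u : X → ℝ) (g : X → ℝ≥0∞) : Prop :=
  ∀ (x : X) (r : ℝ), 0 < r →
    ⨍⁻ y in ball x r, ENNReal.ofReal |u y - ⨍ z in ball x r, u z ∂μ| ∂μ ≤
      ENNReal.ofReal (C * r) * (⨍⁻ y in ball x (Λ * r), g y ^ p ∂μ) ^ (1 / p)

/-- The `p`-Poincaré inequality with constants `C`, `Λ` for all couples `(u, lip u)` with `u`
Lipschitz. -/
def PoincareLip {X : Type*} [MetricSpace X] [MeasurableSpace X] (μ : Measure X)
    (p C Λ : ℝ) : Prop :=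
  ∀ u : X → ℝ, (∃ K, LipschitzWith K u) → PoincareCouple μ p C Λ u (lip u)

/-- The `p`-Poincaré inequality with constants `C`, `Λ` for all couples `(u, g)` with `u` Borel and
`g` an `ε`-upper gradient of `u` for some `ε > 0`. -/
def PoincareChain {X : Type*} [MetricSpace X] [MeasurableSpace X] (μ : Measure X)
    (p C Λ : ℝ) : Prop :=
  ∀ (u : X → ℝ) (g : X → ℝ≥0∞), Measurable u →
    (∃ ε : ℝ, 0 < ε ∧ IsEpsUpperGradient ε u g) → PoincareCouple μ p C Λ u g

/-- The metric completion carries its Borel `σ`-algebra. -/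
instance completionMeasurableSpace {X : Type*} [MetricSpace X] :
    MeasurableSpace (UniformSpace.Completion X) :=
  borel _

instance completionBorelSpace {X : Type*} [MetricSpace X] :
    BorelSpace (UniformSpace.Completion X) :=
  ⟨rfl⟩

/-- The measure `E ↦ μ (E ∩ X)` on the metric completion of `X`. -/
def completionMeasure {X : Type*} [MetricSpace X] [MeasurableSpace X] (μ : Measure X) :
    Measure (UniformSpace.Completion X) :=
  μ.map (fun x : X => (x : UniformSpace.Completion X))

theorem completionMeasure_apply {X : Type*} [MetricSpace X] [MeasurableSpace X] [BorelSpace X]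
    (μ : Measure X) {E : Set (UniformSpace.Completion X)} (hE : MeasurableSet E) :
    completionMeasure μ E = μ ((fun x : X => (x : UniformSpace.Completion X)) ⁻¹' E) :=
  Measure.map_apply (UniformSpace.Completion.continuous_coe X).measurable hE

end ChainPoincare

end

/-! From chains to Lipschitz functions: for Lipschitz `u`, the slope at scale `ε'` is an `ε`-upper
gradient whenever `ε < ε'`. As the scale shrinks, slopes converge to `lip u`, bounded by the
Lipschitz constant, so dominated convergence gives the inequality for `lip u`.

The converse is density in energy. Let `u` be bounded with `ε`-upper gradient `g`, and let `g ^ p`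
be integrable on a ball of finite measure. Outside a small set, inner regularity gives a compact set
`K` on which `g ≤ k` and `g` is nearly constant at a small scale. There `u` is Lipschitz: single
steps control close pairs, boundedness controls distant ones. A McShane-type infimum with cost
adapted to `g` extends `u` from `K` to a Lipschitz `v` with `lip v` almost at most `g` on `K` and at
most `4 * k` elsewhere (`exists_lipschitzWith_lip_le`). Integrability of `g ^ p` makes `k ^ p` times
the measure of the exceptional set small, so the energy of `v` barely exceeds that of `g`
(`exists_lipschitz_approx`). Only compactness of `K` is used, never completeness of `X`. Truncation
and Fatou remove the boundedness of `u` (`lintegral_sub_integral_le_of_clamp`).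

For the completion, Lipschitz functions extend uniquely and `lip` of a continuous function is
unchanged by restriction to a dense subspace, so balls centred in `X` give identical inequalities.
The other balls are exhausted from inside by these (`PoincareCouple.of_dense`). -/

namespace ChainPoincare

open Filter Topology

/-! ### Slopes, local Lipschitz constants and upper gradients along chains -/

section Slope

variable {X : Type*} [MetricSpace X]

theorem slopeAt_mono {ε ε' : ℝ} (h : ε ≤ ε') (u : X → ℝ) (x : X) :
    slopeAt ε u x ≤ slopeAt ε' u x :=
  biSup_mono fun _ hy => ball_subset_ball h hy

theorem slopeAt_le_of_forall_edist_le {ε : ℝ} {u : X → ℝ} {x : X} {c : ℝ≥0∞}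
    (h : ∀ y ∈ ball x ε, edist (u y) (u x) ≤ c * edist y x) : slopeAt ε u x ≤ c :=
  iSup₂_le fun y hy => ENNReal.div_le_of_le_mul (h y hy)

theorem edist_le_slopeAt_mul {ε : ℝ} (u : X → ℝ) {x y : X} (hy : y ∈ ball x ε) :
    edist (u y) (u x) ≤ slopeAt ε u x * edist y x := by
  rcases eq_or_ne y x with rfl | hne
  · simp
  · have h0 : edist y x ≠ 0 := by simpa using hne
    rw [← ENNReal.div_le_iff h0 (edist_ne_top _ _)]
    exact le_iSup₂ (f := fun y (_ : y ∈ ball x ε) => edist (u y) (u x) / edist y x) y hy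

theorem slopeAt_le_of_lipschitzWith {K : NNReal} {u : X → ℝ} (hu : LipschitzWith K u) (ε : ℝ)
    (x : X) : slopeAt ε u x ≤ K :=
  slopeAt_le_of_forall_edist_le fun y _ => hu y x

theorem lip_le_slopeAt {ε : ℝ} (hε : 0 < ε) (u : X → ℝ) (x : X) : lip u x ≤ slopeAt ε u x :=
  iInf₂_le ε hε

theorem lip_le_of_lipschitzWith {K : NNReal} {u : X → ℝ} (hu : LipschitzWith K u) (x : X) :
    lip u x ≤ K :=
  (lip_le_slopeAt one_pos u x).trans (slopeAt_le_of_lipschitzWith hu 1 x)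

theorem lip_comp_le {φ : ℝ → ℝ} (hφ : LipschitzWith 1 φ) (u : X → ℝ) (x : X) :
    lip (fun y => φ (u y)) x ≤ lip u x := by
  refine iInf₂_mono fun ε _ => iSup₂_mono fun y _ => ENNReal.div_le_div_right ?_ _
  simpa using hφ (u y) (u x)

theorem tendsto_slopeAt_lip {e : ℕ → ℝ} (he : ∀ n, 0 < e n) (h0 : Tendsto e atTop (𝓝 0))
    (u : X → ℝ) (x : X) : Tendsto (fun n => slopeAt (e n) u x) atTop (𝓝 (lip u x)) := by
  refine tendsto_order.2 ⟨fun a ha => ?_, fun a ha => ?_⟩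
  · exact Eventually.of_forall fun n => ha.trans_le (lip_le_slopeAt (he n) u x)
  · obtain ⟨ε, hε⟩ := iInf_lt_iff.1 ha
    obtain ⟨hε0, hεa⟩ := iInf_lt_iff.1 hε
    filter_upwards [h0.eventually (gt_mem_nhds hε0)] with n hn
    exact (slopeAt_mono hn.le u x).trans_lt hεa

/-- A competitor `y` for `x` stays a competitor for all `z` near `x`, and its difference quotient is
continuous in `z` there because `y ≠ x`. -/
theorem lowerSemicontinuous_slopeAt {u : X → ℝ} (hu : Continuous u) (ε : ℝ) :
    LowerSemicontinuous (slopeAt ε u) := by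
  intro x t ht
  obtain ⟨y, hy⟩ := lt_iSup_iff.1 ht
  obtain ⟨hyε, hyt⟩ := lt_iSup_iff.1 hy
  have hne : y ≠ x := by
    rintro rfl
    simp at hyt
  have hc : ContinuousAt (fun z => edist (u y) (u z) / edist y z) x := by
    refine ENNReal.Tendsto.div ?_ (Or.inr ?_) ?_ (Or.inr ?_)
    · exact (continuous_const.edist hu).continuousAt
    · simpa using hne
    · exact (continuous_const.edist continuous_id).continuousAt
    · exact edist_ne_top _ _
  have hb : ∀ᶠ z in 𝓝 x, y ∈ ball z ε := by
    filter_upwards [isOpen_ball.mem_nhds (mem_ball_comm.1 hyε)] with z hz using mem_ball_comm.1 hz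
  filter_upwards [hc.eventually (lt_mem_nhds hyt), hb] with z hz1 hz2
  exact hz1.trans_le
    (le_iSup₂ (f := fun y (_ : y ∈ ball z ε) => edist (u y) (u z) / edist y z) y hz2)

theorem measurable_slopeAt [MeasurableSpace X] [BorelSpace X] {u : X → ℝ} (hu : Continuous u)
    (ε : ℝ) : Measurable (slopeAt ε u) :=
  (lowerSemicontinuous_slopeAt hu ε).measurable

theorem measurable_lip [MeasurableSpace X] [BorelSpace X] {u : X → ℝ} (hu : Continuous u) :
    Measurable (lip u) :=
  measurable_of_tendsto_metrizable (fun n : ℕ => measurable_slopeAt hu (1 / ((n : ℝ) + 1)))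
    (tendsto_pi_nhds.2 fun x => tendsto_slopeAt_lip (fun n => by positivity)
      tendsto_one_div_add_atTop_nhds_zero_nat u x)

/-- Both sides telescope along a chain, so one-step chains decide whether `g` is an upper gradient.
-/
theorem ofReal_abs_sub_le_chainIntegral {ε : ℝ} {u : X → ℝ} {g : X → ℝ≥0∞}
    (h : ∀ x y, dist x y ≤ ε → edist (u y) (u x) ≤ (g x + g y) / 2 * edist x y) :
    ∀ (N : ℕ) (q : Fin (N + 1) → X), IsEpsChain ε q →
      ENNReal.ofReal |u (q (Fin.last N)) - u (q 0)| ≤ chainIntegral g q := by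
  intro N
  induction N with
  | zero => intro q _; simp
  | succ N ih =>
    intro q hq
    have h1 := ih (fun i => q i.castSucc) (fun i => by simpa using hq i.castSucc)
    have h2 := h _ _ (hq (Fin.last N))
    rw [← Real.dist_eq, ← edist_dist] at h1 ⊢
    have h3 : chainIntegral g q = chainIntegral g (fun i => q i.castSucc) +
        (g (q (Fin.last N).castSucc) + g (q (Fin.last N).succ)) / 2 *
          edist (q (Fin.last N).castSucc) (q (Fin.last N).succ) := by
      unfold chainIntegral
      rw [Fin.sum_univ_castSucc]
      simp
    rw [h3, add_comm (chainIntegral g _)]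
    refine (edist_triangle _ (u (q (Fin.last N).castSucc)) _).trans (add_le_add ?_ ?_)
    · simpa using h2
    · simpa using h1

/-- The slope at either endpoint bounds a step; averaging the two bounds gives the trapezoidal form.
The inequality `ε < ε'` is strict because chains allow steps of length exactly `ε` while slopes use
open balls. -/
theorem isEpsUpperGradient_slopeAt [MeasurableSpace X] [BorelSpace X] {u : X → ℝ}
    (hu : Continuous u) {ε ε' : ℝ} (h : ε < ε') : IsEpsUpperGradient ε u (slopeAt ε' u) := by
  refine ⟨measurable_slopeAt hu ε', ofReal_abs_sub_le_chainIntegral fun x y hxy => ?_⟩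
  have h1 : edist (u y) (u x) ≤ slopeAt ε' u x * edist x y := by
    rw [edist_comm x y]
    exact edist_le_slopeAt_mul u (mem_ball'.2 (hxy.trans_lt h))
  have h2 : edist (u y) (u x) ≤ slopeAt ε' u y * edist x y := by
    rw [edist_comm (u y)]
    exact edist_le_slopeAt_mul u (mem_ball.2 (hxy.trans_lt h))
  calc edist (u y) (u x) = (edist (u y) (u x) + edist (u y) (u x)) / 2 := by
        rw [ENNReal.add_div, ENNReal.add_halves]
    _ ≤ (slopeAt ε' u x * edist x y + slopeAt ε' u y * edist x y) / 2 := by gcongr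
    _ = _ := by rw [← add_mul, div_eq_mul_inv, div_eq_mul_inv]; ring

theorem IsEpsUpperGradient.edist_le [MeasurableSpace X] {ε : ℝ} {u : X → ℝ} {g : X → ℝ≥0∞}
    (h : IsEpsUpperGradient ε u g) {x y : X} (hxy : dist x y ≤ ε) :
    edist (u y) (u x) ≤ (g x + g y) / 2 * edist x y := by
  have := h.2 1 ![x, y] (fun i => by fin_cases i; simpa using hxy)
  rw [← Real.dist_eq, ← edist_dist] at this
  simpa [chainIntegral] using this

theorem IsEpsUpperGradient.comp [MeasurableSpace X] {ε : ℝ} {u : X → ℝ} {g : X → ℝ≥0∞}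
    (h : IsEpsUpperGradient ε u g) {φ : ℝ → ℝ} (hφ : LipschitzWith 1 φ) :
    IsEpsUpperGradient ε (fun x => φ (u x)) g := by
  refine ⟨h.1, ofReal_abs_sub_le_chainIntegral (u := fun x => φ (u x))
    fun x y hxy => le_trans ?_ (h.edist_le hxy)⟩
  simpa using hφ (u y) (u x)

end Slope

/-! ### Lipschitz extension with a controlled local constant -/

/-- If `g` varies by at most `ω` at scale `τ` on `K` and is an upper gradient of `u` on pairs of
points of `K` at that scale, then `u` has a Lipschitz extension off `K` whose local Lipschitz
constant on `K` is at most `g + 3 ω`. -/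
theorem exists_lipschitzWith_lip_le {X : Type*} [MetricSpace X] {K : Set X} {u g : X → ℝ}
    {k : NNReal} {ω τ : ℝ} (hω : 0 < ω) (hωk : ω ≤ k) (hτ : 0 < τ)
    (hu : ∀ x ∈ K, ∀ y ∈ K, |u x - u y| ≤ k * dist x y)
    (h2 : ∀ x ∈ K, ∀ y ∈ K, dist x y ≤ τ → |u x - u y| ≤ (g x + g y) / 2 * dist x y)
    (hg : ∀ x ∈ K, ∀ y ∈ K, dist x y ≤ τ → |g x - g y| ≤ ω)
    (hg0 : ∀ x ∈ K, 0 ≤ g x) (hgk : ∀ x ∈ K, g x ≤ k) :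
    ∃ v : X → ℝ, LipschitzWith (4 * k) v ∧ (∀ x ∈ K, v x = u x) ∧
      ∀ x ∈ K, lip v x ≤ ENNReal.ofReal (g x + 3 * ω) := by
  rcases K.eq_empty_or_nonempty with rfl | hK
  · exact ⟨fun _ => 0, (LipschitzWith.const (0 : ℝ)).weaken zero_le, by simp, by simp⟩
  have hk0 : (0 : ℝ) ≤ k := k.2
  have : Nonempty K := hK.to_subtype
  -- The first branch, with slope just above `g y`, governs short distances. The second is
  -- nonpositive up to `τ / 2` and at least `2 * k * t` for `t ≥ τ`, which beats the oscillation of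
  -- `u`. Since `g y + 2 * ω ≤ 3 * k`, both branches have slope at most `4 * k`.
  let c : X → ℝ → ℝ := fun y t => max ((g y + 2 * ω) * t) (4 * k * (t - τ / 2))
  have c_le : ∀ y ∈ K, ∀ s t : ℝ, 0 ≤ t → c y s ≤ c y (s - t) + 4 * k * t := by
    intro y hy s t ht
    have := hgk y hy
    refine max_le ?_ ?_
    · have h1 : (g y + 2 * ω) * t ≤ 4 * k * t := by
        apply mul_le_mul_of_nonneg_right _ ht; linarith
      have h3 := le_max_left ((g y + 2 * ω) * (s - t)) (4 * k * ((s - t) - τ / 2))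
      simp only [c]; nlinarith
    · have h3 := le_max_right ((g y + 2 * ω) * (s - t)) (4 * k * ((s - t) - τ / 2))
      simp only [c]; nlinarith
  have c_mono : ∀ y ∈ K, ∀ s t : ℝ, s ≤ t → c y s ≤ c y t := by
    intro y hy s t hst
    have := hg0 y hy
    exact max_le_max (by gcongr) (by gcongr)
  have c_lip : ∀ y ∈ K, ∀ x z, c y (dist x y) ≤ c y (dist z y) + 4 * k * dist x z := by
    intro y hy x z
    refine (c_le y hy _ (dist x z) dist_nonneg).trans ?_
    have : dist x y - dist x z ≤ dist z y := by linarith [dist_triangle x z y]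
    linarith [c_mono y hy _ _ this]
  -- At a point `x` of `K`, every competitor `y` loses to `x` by a margin growing with the distance;
  -- this margin survives a small displacement of `x`.
  have gain : ∀ x ∈ K, ∀ y ∈ K, u x + ω * min (dist x y) τ ≤ u y + c y (dist x y) := by
    intro x hx y hy
    rcases le_total (dist x y) τ with h | h
    · rw [min_eq_left h]
      have h3 := (abs_le.1 (h2 x hx y hy h)).2
      have h4 := (abs_le.1 (hg x hx y hy h)).2
      have h5 := le_max_left ((g y + 2 * ω) * dist x y) (4 * k * (dist x y - τ / 2))
      have h6 : (g x + g y) / 2 * dist x y ≤ (g y + ω) * dist x y := by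
        apply mul_le_mul_of_nonneg_right _ dist_nonneg; linarith
      simp only [c]; linarith
    · rw [min_eq_right h]
      have h3 := (abs_le.1 (hu x hx y hy)).2
      have h5 := le_max_right ((g y + 2 * ω) * dist x y) (4 * k * (dist x y - τ / 2))
      have h6 : ω * τ ≤ k * τ := by gcongr
      have h7 : (k : ℝ) * τ ≤ k * dist x y := by gcongr
      simp only [c]; linarith
  let f : K → X → ℝ := fun y x => u y + c y (dist x y)
  have f_lip : ∀ (y : K) x z, f y x ≤ f y z + 4 * k * dist x z := by
    intro y x z
    have := c_lip y y.2 x z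
    simp only [f]; linarith
  obtain ⟨x₀, hx₀⟩ := hK
  have bdd : ∀ x, BddBelow (Set.range fun y : K => f y x) := by
    intro x
    refine ⟨u x₀ - 4 * k * dist x₀ x, ?_⟩
    rintro _ ⟨y, rfl⟩
    have h1 := f_lip y x₀ x
    have h3 := gain x₀ hx₀ y y.2
    have h4 : 0 ≤ ω * min (dist x₀ y) τ := by positivity
    simp only [f] at h1 ⊢; linarith
  let v : X → ℝ := fun x => ⨅ y : K, f y x
  have v_le : ∀ x (y : K), v x ≤ f y x := fun x y => ciInf_le (bdd x) y
  have v_lip : ∀ x z, v x ≤ v z + 4 * k * dist x z := by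
    intro x z
    rw [← sub_le_iff_le_add]
    refine le_ciInf fun y => ?_
    linarith [v_le x y, f_lip y x z]
  have c_zero : ∀ y, c y 0 = 0 := by
    intro y
    simp only [c, mul_zero]
    apply max_eq_left
    have : 0 ≤ (k : ℝ) * τ := by positivity
    linarith
  have v_eq : ∀ x ∈ K, v x = u x := by
    intro x hx
    apply le_antisymm
    · simpa [f, c_zero] using v_le x ⟨x, hx⟩
    · refine le_ciInf fun y => ?_
      have h3 := gain x hx y y.2
      have h4 : 0 ≤ ω * min (dist x y) τ := by positivity
      simp only [f]; linarith
  refine ⟨v, LipschitzWith.of_le_add_mul _ (by simpa using v_lip), v_eq, fun x hx => ?_⟩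
  have hkp : (0 : ℝ) < k := hω.trans_le hωk
  -- The first bound keeps the cost from `x` on its first branch; the second keeps `4 * k * dist z
  -- x` below the margin of competitors at distance at least `τ / 4`.
  let δ : ℝ := min (τ / 4) (ω * (τ / 4) / (4 * k))
  have hδ : 0 < δ := by positivity
  refine (lip_le_slopeAt hδ v x).trans (slopeAt_le_of_forall_edist_le fun z hz => ?_)
  have hz1 : dist z x ≤ τ / 4 := (mem_ball.1 hz).le.trans (min_le_left _ _)
  have hz2 : 4 * k * dist z x ≤ ω * (τ / 4) := by
    have := (mem_ball.1 hz).le.trans (min_le_right _ _)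
    rwa [le_div_iff₀ (by positivity), mul_comm] at this
  have hgx := hg0 x hx
  have hd : 0 ≤ dist z x := dist_nonneg
  rw [edist_dist, edist_dist z x, ← ENNReal.ofReal_mul (by positivity)]
  apply ENNReal.ofReal_le_ofReal
  rw [Real.dist_eq, abs_le, v_eq x hx]
  constructor
  · suffices h : u x - (g x + 3 * ω) * dist z x ≤ v z by linarith
    refine le_ciInf fun y => ?_
    -- Near competitors have slope `g y + 2 * ω ≤ g x + 3 * ω`; far ones are excluded by `gain`.
    rcases le_total (dist x y) (τ / 4) with h | h
    · have h3 := gain x hx y y.2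
      have h4 := (abs_le.1 (h2 x hx y y.2 (by linarith))).2
      have h5 := (abs_le.1 (hg x hx y y.2 (by linarith)))
      have h6 := le_max_left ((g y + 2 * ω) * dist z y) (4 * k * (dist z y - τ / 2))
      have h7 : dist x y - dist z x ≤ dist z y := by
        have := dist_triangle x z y
        rw [dist_comm x z] at this; linarith
      have hgy := hg0 y y.2
      have h8 : (g y + 2 * ω) * (dist x y - dist z x) ≤ (g y + 2 * ω) * dist z y := by gcongr
      have h9 : (g x + g y) / 2 * dist x y ≤ (g y + 2 * ω) * dist x y := by
        apply mul_le_mul_of_nonneg_right _ dist_nonneg; linarith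
      have h10 : (g y + 2 * ω) * dist z x ≤ (g x + 3 * ω) * dist z x := by
        apply mul_le_mul_of_nonneg_right _ dist_nonneg; linarith
      simp only [f, c]; linarith
    · have h3 := gain x hx y y.2
      have h4 := f_lip y x z
      rw [dist_comm x z] at h4
      have h5 : ω * (τ / 4) ≤ ω * min (dist x y) τ := by
        gcongr
        exact le_min h (by linarith)
      have h6 : 0 ≤ (g x + 3 * ω) * dist z x := by positivity
      simp only [f] at h4 ⊢; linarith
  · have h3 := v_le z ⟨x, hx⟩
    have h4 : c x (dist z x) = (g x + 2 * ω) * dist z x := by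
      apply max_eq_left
      have h5 : (k : ℝ) * (dist z x - τ / 2) ≤ 0 := mul_nonpos_of_nonneg_of_nonpos hk0 (by linarith)
      have h6 : 0 ≤ (g x + 2 * ω) * dist z x := by positivity
      linarith
    simp only [f, h4] at h3
    nlinarith

/-- For `k ≥ 1` and `p ≥ 1`, `g > k` forces `g ^ p ≥ k`, so by Markov the superlevel sets shrink to
measure zero; absolute continuity of the integral concludes. -/
theorem tendsto_setLIntegral_lt_rpow {X : Type*} [MeasurableSpace X] {μ : Measure X}
    {B : Set X} {p : ℝ} (hp : 1 ≤ p) {g : X → ℝ≥0∞} (hg : Measurable g) (hgp : ∫⁻ x in B, g x ^ p ∂μ ≠ ∞) :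
    Tendsto (fun k : ℕ => ∫⁻ x in {x | (k : ℝ≥0∞) < g x}, g x ^ p ∂μ.restrict B) atTop (𝓝 0) := by
  have hp0 : 0 < p := one_pos.trans_le hp
  refine tendsto_setLIntegral_zero hgp ?_
  refine tendsto_of_tendsto_of_tendsto_of_le_of_le' tendsto_const_nhds
    (h := fun k : ℕ => (∫⁻ x in B, g x ^ p ∂μ) / k) ?_ (Eventually.of_forall fun _ => zero_le) ?_
  · simpa using ENNReal.Tendsto.const_div ENNReal.tendsto_nat_nhds_top (Or.inr hgp)
  · filter_upwards [eventually_ge_atTop 1] with k hk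
    have hk1 : (1 : ℝ≥0∞) ≤ k := by exact_mod_cast hk
    refine le_trans (measure_mono fun x hx => ?_)
      (meas_ge_le_lintegral_div (hg.pow_const p).aemeasurable (by positivity) (by simp))
    have hx1 : (k : ℝ≥0∞) < g x := hx
    calc (k : ℝ≥0∞) ≤ g x := hx1.le
      _ = g x ^ (1 : ℝ) := by simp
      _ ≤ g x ^ p := ENNReal.rpow_le_rpow_of_exponent_le (hk1.trans hx1.le) hp

/-! ### Lusin-type compact sets -/

section Approximation

variable {X : Type*} [MetricSpace X] [MeasurableSpace X] [BorelSpace X]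

/-- Each of the finitely many level sets is approximated from inside by a compact set, losing at
most `η / J`. Disjoint compact sets lie at positive distance from each other, so sufficiently close
points of the union share a level. -/
theorem exists_isCompact_eq_of_dist_le (μ : Measure X) [μ.InnerRegularCompactLTTop] {s : Set X}
    (hs : MeasurableSet s) (hμs : μ s ≠ ∞) {f : X → ℕ} (hf : Measurable f) {J : ℕ}
    (hJ : ∀ x ∈ s, f x < J) {η : ℝ≥0∞} (hη : η ≠ 0) :
    ∃ K ⊆ s, IsCompact K ∧ μ (s \ K) ≤ η ∧
      ∃ τ : ℝ, 0 < τ ∧ ∀ x ∈ K, ∀ y ∈ K, dist x y ≤ τ → f x = f y := by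
  have hm : ∀ j, MeasurableSet (s ∩ f ⁻¹' {j}) := fun j => hs.inter (hf (measurableSet_singleton j))
  have hfin : ∀ j, μ (s ∩ f ⁻¹' {j}) ≠ ∞ := fun j =>
    measure_ne_top_of_subset Set.inter_subset_left hμs
  have hη' : η / J ≠ 0 := ENNReal.div_ne_zero.2 ⟨hη, by simp⟩
  choose K hKs hKc hKμ using fun j => (hm j).exists_isCompact_sdiff_lt (hfin j) hη'
  have key : ∀ᶠ τ : ℝ in 𝓝[>] 0, ∀ i ∈ Finset.range J, ∀ j ∈ Finset.range J, i ≠ j →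
      ∀ x ∈ K i, ∀ y ∈ K j, τ < dist x y := by
    rw [eventually_all_finset]; intro i _
    rw [eventually_all_finset]; intro j _
    by_cases hij : i = j
    · simp [hij]
    have hdisj : Disjoint (K i) (K j) := by
      rw [Set.disjoint_left]
      intro x hx hx'
      exact hij ((hKs i hx).2.symm.trans (hKs j hx').2)
    obtain ⟨r, hr, h⟩ := exists_pos_forall_lt_edist (hKc i) (hKc j).isClosed hdisj
    filter_upwards [Ioo_mem_nhdsGT (show (0 : ℝ) < r from hr)] with τ hτ _ x hx y hy
    have := h x hx y hy
    rw [edist_dist, ENNReal.lt_ofReal_iff_toReal_lt (by simp)] at this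
    exact hτ.2.trans (by simpa using this)
  obtain ⟨τ, hτ, hτ0⟩ := (key.and self_mem_nhdsWithin).exists
  refine ⟨⋃ j ∈ Finset.range J, K j, ?_, ?_, ?_, τ, hτ0, ?_⟩
  · exact Set.iUnion₂_subset fun j _ => (hKs j).trans Set.inter_subset_left
  · exact (Finset.range J).isCompact_biUnion fun j _ => hKc j
  · have hsub : s \ ⋃ j ∈ Finset.range J, K j ⊆
        ⋃ j ∈ Finset.range J, (s ∩ f ⁻¹' {j}) \ K j := by
      rintro x ⟨hx, hxK⟩
      simp only [Set.mem_iUnion, not_exists] at hxK ⊢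
      have := Finset.mem_range.2 (hJ x hx)
      exact ⟨f x, this, ⟨hx, rfl⟩, hxK _ this⟩
    calc μ (s \ ⋃ j ∈ Finset.range J, K j)
        ≤ ∑ j ∈ Finset.range J, μ ((s ∩ f ⁻¹' {j}) \ K j) :=
          (measure_mono hsub).trans (measure_biUnion_finset_le _ _)
      _ ≤ ∑ j ∈ Finset.range J, η / J := Finset.sum_le_sum fun j _ => (hKμ j).le
      _ ≤ η := by
        rw [Finset.sum_const, Finset.card_range, nsmul_eq_mul]
        exact ENNReal.mul_div_le
  · intro x hx y hy hxy
    simp only [Set.mem_iUnion] at hx hy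
    obtain ⟨i, hi, hxi⟩ := hx
    obtain ⟨j, hj, hyj⟩ := hy
    have hij : i = j := by
      by_contra hij
      exact absurd hxy (not_le.2 (hτ i hi j hj hij x hxi y hyj))
    exact (hKs i hxi).2.trans (hij.trans (hKs j hyj).2.symm)

end Approximation

theorem lipschitzWith_clamp (M : ℝ) : LipschitzWith 1 fun t : ℝ => max (-M) (min t M) :=
  (LipschitzWith.id.min_const M).const_max (-M)

theorem abs_clamp_le {M : ℝ} (hM : 0 ≤ M) (t : ℝ) : |max (-M) (min t M)| ≤ M :=
  abs_le.2 ⟨le_max_left _ _, max_le (by linarith) (min_le_right _ _)⟩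

theorem clamp_eq_self {M t : ℝ} (h : |t| ≤ M) : max (-M) (min t M) = t := by
  rw [min_eq_left (abs_le.1 h).2, max_eq_right (abs_le.1 h).1]

/-! ### Density in energy of Lipschitz functions -/

section Approximation

variable {X : Type*} [MetricSpace X] [MeasurableSpace X]

theorem IsEpsUpperGradient.abs_sub_le {ε : ℝ} {u : X → ℝ} {g : X → ℝ≥0∞}
    (h : IsEpsUpperGradient ε u g) {x y : X} (hx : g x ≠ ∞) (hy : g y ≠ ∞) (hxy : dist x y ≤ ε) :
    |u x - u y| ≤ ((g x).toReal + (g y).toReal) / 2 * dist x y := by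
  have h1 := h.edist_le hxy
  rw [edist_dist, edist_dist] at h1
  have h2 := ENNReal.toReal_mono
    (ENNReal.mul_ne_top (ENNReal.div_ne_top (ENNReal.add_ne_top.2 ⟨hx, hy⟩) (by simp))
      ENNReal.ofReal_ne_top) h1
  rw [ENNReal.toReal_ofReal dist_nonneg, ENNReal.toReal_mul, ENNReal.toReal_div,
    ENNReal.toReal_add hx hy, ENNReal.toReal_ofReal dist_nonneg, dist_comm, Real.dist_eq] at h2
  simpa using h2

variable [BorelSpace X]

/-- A bounded function with an upper gradient `g ≤ k` on a set `s` coincides on a large compact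
subset of `s` with a Lipschitz function whose local Lipschitz constant is almost `g` there. -/
theorem exists_isCompact_exists_lipschitzWith (μ : Measure X) [μ.InnerRegularCompactLTTop]
    {s : Set X} (hs : MeasurableSet s) (hμs : μ s ≠ ∞) {u : X → ℝ} {g : X → ℝ≥0∞} {M ε : ℝ}
    (hM : 0 ≤ M) (huM : ∀ x, |u x| ≤ M) (hε : 0 < ε) (hg : IsEpsUpperGradient ε u g)
    {k : NNReal} (hk : 1 ≤ k) (hkM : 2 * M ≤ k * ε) (hgk : ∀ x ∈ s, g x ≤ k)
    {ω : ℝ} (hω : 0 < ω) (hω1 : ω ≤ 1) {η : ℝ≥0∞} (hη : η ≠ 0) :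
    ∃ K ⊆ s, IsCompact K ∧ μ (s \ K) ≤ η ∧ ∃ v : X → ℝ, LipschitzWith (4 * k) v ∧
      (∀ x, |v x| ≤ M) ∧ (∀ x ∈ K, v x = u x) ∧ ∀ x ∈ K, lip v x ≤ g x + ENNReal.ofReal (3 * ω) := by
  have hgt : ∀ x ∈ s, g x ≠ ∞ := fun x hx => ((hgk x hx).trans_lt ENNReal.coe_lt_top).ne
  have hgr : ∀ x ∈ s, (g x).toReal ≤ k := fun x hx =>
    ENNReal.toReal_le_coe_of_le_coe (hgk x hx)
  -- Quantizing `g` with step `ω` gives finitely many levels on `s`, and equal levels mean values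
  -- within `ω`.
  have hf : Measurable fun x => ⌊(g x).toReal / ω⌋₊ :=
    Nat.measurable_floor.comp (hg.1.ennreal_toReal.div_const ω)
  have hJ : ∀ x ∈ s, ⌊(g x).toReal / ω⌋₊ < ⌊(k : ℝ) / ω⌋₊ + 1 := by
    intro x hx
    rw [Nat.lt_succ_iff]
    have := hgr x hx
    exact Nat.floor_le_floor (by gcongr)
  obtain ⟨K, hKs, hKc, hKμ, τ, hτ, hKτ⟩ := exists_isCompact_eq_of_dist_le μ hs hμs hf hJ hη
  have hosc : ∀ x ∈ K, ∀ y ∈ K, dist x y ≤ τ → |(g x).toReal - (g y).toReal| ≤ ω := by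
    intro x hx y hy hxy
    have h0 := hKτ x hx y hy hxy
    have hx0 : 0 ≤ (g x).toReal / ω := by positivity
    have hy0 : 0 ≤ (g y).toReal / ω := by positivity
    have h1 := Nat.floor_le hx0
    have h2 := Nat.lt_floor_add_one ((g x).toReal / ω)
    have h3 := Nat.floor_le hy0
    have h4 := Nat.lt_floor_add_one ((g y).toReal / ω)
    rw [h0] at h1 h2
    have h5 : |(g x).toReal / ω - (g y).toReal / ω| ≤ 1 := by
      rw [abs_le]; constructor <;> linarith
    rwa [← sub_div, abs_div, abs_of_pos hω, div_le_one hω] at h5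
  have hlip : ∀ x ∈ K, ∀ y ∈ K, |u x - u y| ≤ k * dist x y := by
    intro x hx y hy
    -- Beyond distance `ε` the upper gradient says nothing about a single step, but `2 * M ≤ k * ε`
    -- does.
    rcases le_total (dist x y) ε with h | h
    · refine (hg.abs_sub_le (hgt x (hKs hx)) (hgt y (hKs hy)) h).trans ?_
      have := hgr x (hKs hx)
      have := hgr y (hKs hy)
      apply mul_le_mul_of_nonneg_right _ dist_nonneg
      linarith
    · have h1 : |u x - u y| ≤ 2 * M := by
        have h2 := abs_le.1 (huM x)
        have h3 := abs_le.1 (huM y)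
        rw [abs_le]; constructor <;> linarith
      have : (k : ℝ) * ε ≤ k * dist x y := by gcongr
      linarith
  obtain ⟨v, hvL, hvu, hvl⟩ := exists_lipschitzWith_lip_le (g := fun x => (g x).toReal)
    (τ := min τ ε) hω (hω1.trans (by exact_mod_cast hk)) (lt_min hτ hε) hlip
    (fun x hx y hy h => hg.abs_sub_le (hgt x (hKs hx)) (hgt y (hKs hy))
      (h.trans (min_le_right _ _)))
    (fun x hx y hy h => hosc x hx y hy (h.trans (min_le_left _ _)))
    (fun x _ => ENNReal.toReal_nonneg) (fun x hx => hgr x (hKs hx))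
  refine ⟨K, hKs, hKc, hKμ, fun x => max (-M) (min (v x) M), ?_, fun x => abs_clamp_le hM _,
    fun x hx => ?_, fun x hx => (lip_comp_le (lipschitzWith_clamp M) v x).trans ?_⟩
  · have := (lipschitzWith_clamp M).comp hvL
    rwa [one_mul] at this
  · simp only [hvu x hx]
    exact clamp_eq_self (huM x)
  · refine (hvl x hx).trans ?_
    rw [ENNReal.ofReal_add ENNReal.toReal_nonneg (by positivity),
      ENNReal.ofReal_toReal (hgt x (hKs hx))]

/-- Density in energy of Lipschitz functions among the bounded functions with an upper gradient. -/
theorem exists_lipschitz_approx (μ : Measure X) [μ.InnerRegularCompactLTTop]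
    {B : Set X} (hB : MeasurableSet B) (hμB : μ B ≠ ∞) {p : ℝ} (hp : 1 ≤ p) {u : X → ℝ}
    {g : X → ℝ≥0∞} {M ε : ℝ} (hM : 0 ≤ M) (huM : ∀ x, |u x| ≤ M) (hε : 0 < ε)
    (hg : IsEpsUpperGradient ε u g) (hgp : ∫⁻ x in B, g x ^ p ∂μ ≠ ∞) {θ : ℝ≥0∞} (hθ : θ ≠ 0) :
    ∃ v : X → ℝ, (∃ L, LipschitzWith L v) ∧ (∀ x, |v x| ≤ M) ∧
      ∫⁻ x in B, ENNReal.ofReal |v x - u x| ∂μ ≤ θ ∧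
      (∫⁻ x in B, lip v x ^ p ∂μ) ^ (1 / p) ≤ (∫⁻ x in B, g x ^ p ∂μ) ^ (1 / p) + θ := by
  have hp0 : 0 < p := one_pos.trans_le hp
  have hθ2 : θ / 2 ≠ 0 := by simpa using hθ
  -- the parameters
  obtain ⟨n, hn0, hn⟩ := ENNReal.exists_nnreal_pos_mul_lt
    (ENNReal.rpow_ne_top_of_nonneg (y := 1 / p) (by positivity) hμB) hθ2
  -- The uniform error `3 * ω ≤ n` in `lip v` costs at most `n * μ B ^ (1 / p) < θ / 2` in the `L^p`
  -- norm.
  let ω : ℝ := min 1 (n / 3)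
  have hω : 0 < ω := lt_min one_pos (by positivity)
  have hωn : ENNReal.ofReal (3 * ω) ≤ n := by
    rw [← ENNReal.ofReal_coe_nnreal]
    apply ENNReal.ofReal_le_ofReal
    have : ω ≤ n / 3 := min_le_right _ _
    linarith
  -- One `σ` must serve two bounds on the exceptional set, of weighted measure at most `σ + σ`: the
  -- energy of the constant `4 * k`, and the `L^1` error `2 * M`.
  let c : ℝ≥0∞ := 2 * max (4 ^ p) (ENNReal.ofReal (2 * M))
  have hc : c ≠ ∞ := ENNReal.mul_ne_top (by simp) (by
    simp only [ne_eq, max_eq_top, not_or]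
    exact ⟨ENNReal.rpow_ne_top_of_nonneg hp0.le (by simp), ENNReal.ofReal_ne_top⟩)
  let d : ℝ≥0∞ := min ((θ / 2) ^ p) θ
  have hd : d ≠ 0 := by
    have : 0 < d := lt_min (ENNReal.rpow_pos_of_nonneg (pos_iff_ne_zero.2 hθ2) hp0.le)
      (pos_iff_ne_zero.2 hθ)
    exact this.ne'
  let σ : ℝ≥0∞ := d / c
  have hσ : 0 < σ := ENNReal.div_pos hd hc
  have hσd : c * σ ≤ d := ENNReal.mul_div_le
  have hσ1 : 4 ^ p * (σ + σ) ≤ (θ / 2) ^ p := by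
    refine le_trans ?_ (hσd.trans (min_le_left _ _))
    rw [← two_mul, ← mul_assoc, mul_comm _ (2 : ℝ≥0∞)]
    simp only [c]
    gcongr
    exact le_max_left _ _
  have hσ2 : ENNReal.ofReal (2 * M) * (σ + σ) ≤ θ := by
    refine le_trans ?_ (hσd.trans (min_le_right _ _))
    rw [← two_mul, ← mul_assoc, mul_comm _ (2 : ℝ≥0∞)]
    simp only [c]
    gcongr
    exact le_max_right _ _
  obtain ⟨k, hkσ, hk1, hkM⟩ :=
    (((tendsto_setLIntegral_lt_rpow hp hg.1 hgp).eventually (gt_mem_nhds hσ)).and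
      ((eventually_ge_atTop 1).and (tendsto_natCast_atTop_atTop.eventually_ge_atTop
        (2 * M / ε)))).exists
  rw [div_le_iff₀ hε] at hkM
  have hk1' : (1 : ℝ≥0∞) ≤ k := by exact_mod_cast hk1
  have hkp : (1 : ℝ≥0∞) ≤ (k : ℝ≥0∞) ^ p := ENNReal.one_le_rpow hk1' hp0
  have hkp' : (k : ℝ≥0∞) ^ p ≠ ∞ := ENNReal.rpow_ne_top_of_nonneg hp0.le (by simp)
  -- The measure lost to compactness is later multiplied by `k ^ p`.
  let η : ℝ≥0∞ := σ / (k : ℝ≥0∞) ^ p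
  have hη : η ≠ 0 := (ENNReal.div_pos hσ.ne' hkp').ne'
  have hms : MeasurableSet {x | g x ≤ k} := measurableSet_le hg.1 measurable_const
  obtain ⟨K, hKs, hKc, hKμ, v, hvL, hvM, hvu, hvl⟩ :=
    exists_isCompact_exists_lipschitzWith μ (hB.inter hms)
      (measure_ne_top_of_subset Set.inter_subset_left hμB) hM huM hε hg
      (k := k) (by exact_mod_cast hk1) (by simpa using hkM) (by rintro x ⟨-, hx⟩; simpa using hx)
      hω (min_le_left _ _) hη
  have hKm : MeasurableSet K := hKc.isClosed.measurableSet
  -- the exceptional set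
  have hbad : (k : ℝ≥0∞) ^ p * μ (B \ K) ≤ σ + σ := by
    have h1 : μ (B \ K) ≤ μ ({x | (k : ℝ≥0∞) < g x} ∩ B) + μ ((B ∩ {x | g x ≤ k}) \ K) := by
      refine (measure_mono fun x hx => ?_).trans (measure_union_le _ _)
      rcases lt_or_ge (k : ℝ≥0∞) (g x) with h | h
      · exact Or.inl ⟨h, hx.1⟩
      · exact Or.inr ⟨⟨hx.1, h⟩, hx.2⟩
    have hmlt : MeasurableSet {x | (k : ℝ≥0∞) < g x} := measurableSet_lt measurable_const hg.1
    have h2 : (k : ℝ≥0∞) ^ p * μ ({x | (k : ℝ≥0∞) < g x} ∩ B) ≤ σ := by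
      refine le_trans ?_ hkσ.le
      rw [← Measure.restrict_apply hmlt, ← setLIntegral_const]
      refine setLIntegral_mono (hg.1.pow_const p) fun x hx => ?_
      exact ENNReal.rpow_le_rpow (le_of_lt hx) hp0.le
    have h3 : (k : ℝ≥0∞) ^ p * μ ((B ∩ {x | g x ≤ k}) \ K) ≤ σ := by
      refine le_trans (by gcongr) (ENNReal.mul_div_le : (k : ℝ≥0∞) ^ p * (σ / (k : ℝ≥0∞) ^ p) ≤ σ)
    calc _ ≤ (k : ℝ≥0∞) ^ p * (_ + _) := by gcongr
      _ ≤ _ := by rw [mul_add]; exact add_le_add h2 h3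
  have hbad' : μ (B \ K) ≤ σ + σ :=
    (le_mul_of_one_le_left zero_le hkp).trans hbad
  have hcompl : μ.restrict B Kᶜ = μ (B \ K) := by
    rw [Measure.restrict_apply hKm.compl, Set.inter_comm, Set.sdiff_eq]
  refine ⟨v, ⟨_, hvL⟩, hvM, ?_, ?_⟩
  · calc ∫⁻ x in B, ENNReal.ofReal |v x - u x| ∂μ
        ≤ ∫⁻ x in B, Kᶜ.indicator (fun _ => ENNReal.ofReal (2 * M)) x ∂μ := by
          refine lintegral_mono fun x => ?_
          by_cases hx : x ∈ K
          · simp [hvu x hx]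
          · rw [Set.indicator_of_mem (by simpa using hx)]
            apply ENNReal.ofReal_le_ofReal
            have h2 := abs_le.1 (huM x)
            have h3 := abs_le.1 (hvM x)
            rw [abs_le]; constructor <;> linarith
      _ = ENNReal.ofReal (2 * M) * μ (B \ K) := by
          rw [lintegral_indicator_const hKm.compl, hcompl]
      _ ≤ ENNReal.ofReal (2 * M) * (σ + σ) := by gcongr
      _ ≤ θ := hσ2
  -- Minkowski's inequality is applied to the majorant `g + n + h`, where `h` accounts for the
  -- points off `K`.
  · let h : X → ℝ≥0∞ := Kᶜ.indicator fun _ => 4 * (k : ℝ≥0∞)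
    have hh : Measurable h := measurable_const.indicator hKm.compl
    let e : X → ℝ≥0∞ := fun _ => n
    have hle : ∀ x, lip v x ≤ ((g + e) + h) x := by
      intro x
      by_cases hx : x ∈ K
      · refine (hvl x hx).trans (le_trans ?_ le_self_add)
        simp only [Pi.add_apply, e]
        gcongr
      · refine (lip_le_of_lipschitzWith hvL x).trans ?_
        simp only [Pi.add_apply, h]
        rw [Set.indicator_of_mem (by simpa using hx)]
        refine le_trans ?_ le_add_self
        simp
    have hn' : (∫⁻ _ in B, (n : ℝ≥0∞) ^ p ∂μ) ^ (1 / p) ≤ θ / 2 := by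
      rw [setLIntegral_const, ENNReal.mul_rpow_of_nonneg _ _ (by positivity), ← ENNReal.rpow_mul,
        mul_one_div_cancel hp0.ne', ENNReal.rpow_one]
      exact hn.le
    have hh' : (∫⁻ x in B, h x ^ p ∂μ) ^ (1 / p) ≤ θ / 2 := by
      rw [one_div, ENNReal.rpow_inv_le_iff hp0]
      have : ∀ x, h x ^ p = Kᶜ.indicator (fun _ => (4 * (k : ℝ≥0∞)) ^ p) x := by
        intro x
        by_cases hx : x ∈ K
        · simp [h, hx, hp0]
        · simp [h, hx]
      simp_rw [this]
      rw [lintegral_indicator_const hKm.compl, hcompl, ENNReal.mul_rpow_of_nonneg _ _ hp0.le,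
        mul_assoc]
      exact le_trans (by gcongr) hσ1
    calc (∫⁻ x in B, lip v x ^ p ∂μ) ^ (1 / p)
        ≤ (∫⁻ x in B, ((g + e) + h) x ^ p ∂μ) ^ (1 / p) := by
          gcongr with x
          exact hle x
      _ ≤ (∫⁻ x in B, (g + e) x ^ p ∂μ) ^ (1 / p) +
            (∫⁻ x in B, h x ^ p ∂μ) ^ (1 / p) :=
          ENNReal.lintegral_Lp_add_le (hg.1.add measurable_const).aemeasurable hh.aemeasurable hp
      _ ≤ ((∫⁻ x in B, g x ^ p ∂μ) ^ (1 / p) + (∫⁻ _ in B, (n : ℝ≥0∞) ^ p ∂μ) ^ (1 / p)) +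
            (∫⁻ x in B, h x ^ p ∂μ) ^ (1 / p) := by
          gcongr
          exact ENNReal.lintegral_Lp_add_le hg.1.aemeasurable aemeasurable_const hp
      _ ≤ (∫⁻ x in B, g x ^ p ∂μ) ^ (1 / p) + θ := by
          rw [add_assoc]
          gcongr
          exact (add_le_add hn' hh').trans (ENNReal.add_halves θ).le

end Approximation

/-! ### Stability of the mean oscillation -/

section Oscillation

variable {α : Type*} [MeasurableSpace α] {ν : Measure α}

theorem lintegral_sub_integral_le (hν : ν Set.univ ≤ 1) {u v : α → ℝ} (hu : Integrable u ν)
    (hv : Integrable v ν) :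
    ∫⁻ x, ‖u x - ∫ z, u z ∂ν‖ₑ ∂ν ≤
      ∫⁻ x, ‖v x - ∫ z, v z ∂ν‖ₑ ∂ν + 2 * ∫⁻ x, ‖v x - u x‖ₑ ∂ν := by
  have h1 : ‖(∫ z, v z ∂ν) - ∫ z, u z ∂ν‖ₑ ≤ ∫⁻ x, ‖v x - u x‖ₑ ∂ν := by
    rw [← integral_sub hv hu]
    exact enorm_integral_le_lintegral_enorm _
  have hm : AEMeasurable (fun x => ‖v x - u x‖ₑ) ν := (hv.sub hu).1.enorm
  calc ∫⁻ x, ‖u x - ∫ z, u z ∂ν‖ₑ ∂ν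
      ≤ ∫⁻ x, ((‖v x - ∫ z, v z ∂ν‖ₑ + ‖v x - u x‖ₑ) +
          ‖(∫ z, v z ∂ν) - ∫ z, u z ∂ν‖ₑ) ∂ν := by
        refine lintegral_mono fun x => ?_
        have : u x - ∫ z, u z ∂ν = ((v x - ∫ z, v z ∂ν) - (v x - u x)) +
          ((∫ z, v z ∂ν) - ∫ z, u z ∂ν) := by ring
        rw [this]
        refine (enorm_add_le _ _).trans ?_
        gcongr
        exact enorm_sub_le
    _ = (∫⁻ x, ‖v x - ∫ z, v z ∂ν‖ₑ ∂ν + ∫⁻ x, ‖v x - u x‖ₑ ∂ν) +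
          ‖(∫ z, v z ∂ν) - ∫ z, u z ∂ν‖ₑ * ν Set.univ := by
        rw [lintegral_add_right _ measurable_const, lintegral_add_right' _ hm, lintegral_const]
    _ ≤ (∫⁻ x, ‖v x - ∫ z, v z ∂ν‖ₑ ∂ν + ∫⁻ x, ‖v x - u x‖ₑ ∂ν) +
          (∫⁻ x, ‖v x - u x‖ₑ ∂ν) * 1 := by gcongr
    _ = _ := by rw [mul_one, add_assoc, two_mul]

/-- A function whose truncations have bounded mean oscillation is integrable, and its mean
oscillation has the same bound. -/
theorem lintegral_sub_integral_le_of_clamp [IsProbabilityMeasure ν] {u : α → ℝ} (hu : Measurable u)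
    {R : ℝ≥0∞} (h : ∀ n : ℕ, ∫⁻ x, ‖max (-(n : ℝ)) (min (u x) n) -
      ∫ z, max (-(n : ℝ)) (min (u z) n) ∂ν‖ₑ ∂ν ≤ R) :
    ∫⁻ x, ‖u x - ∫ z, u z ∂ν‖ₑ ∂ν ≤ R := by
  rcases eq_or_ne R ∞ with rfl | hR
  · exact le_top
  let w : ℕ → α → ℝ := fun n x => max (-(n : ℝ)) (min (u x) n)
  have hw : ∀ n, Measurable (w n) := fun n => measurable_const.max (hu.min measurable_const)
  have hwu : ∀ n x, |w n x| ≤ |u x| := by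
    intro n x
    have := lipschitzWith_clamp n
    have h1 := this.dist_le_mul (u x) 0
    simpa [Real.dist_eq, w] using h1
  have hlim : ∀ x, Tendsto (fun n => w n x) atTop (𝓝 (u x)) := by
    intro x
    refine tendsto_const_nhds.congr' ?_
    filter_upwards [tendsto_natCast_atTop_atTop.eventually_ge_atTop |u x|] with n hn
    exact (clamp_eq_self hn).symm
  -- On a set carrying more than half the mass, truncations are bounded by `t`, so their means are
  -- bounded uniformly by the oscillation bound plus `t`. Fatou then gives integrability of `u`.
  obtain ⟨t, ht⟩ : ∃ t : ℕ, (2 : ℝ≥0∞)⁻¹ < ν {x | |u x| ≤ t} := by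
    have hmono : Monotone fun t : ℕ => {x | |u x| ≤ t} := fun a b hab x (hx : |u x| ≤ a) =>
      hx.trans (by exact_mod_cast hab)
    have hU : ⋃ t : ℕ, {x | |u x| ≤ t} = Set.univ :=
      Set.eq_univ_of_forall fun x => Set.mem_iUnion.2 (exists_nat_ge |u x|)
    have h1 := tendsto_measure_iUnion_atTop (μ := ν) hmono
    rw [hU, measure_univ] at h1
    exact (h1.eventually (lt_mem_nhds ENNReal.one_half_lt_one)).exists
  have hmeas : ∀ n, Measurable fun x => ‖w n x - ∫ z, w n z ∂ν‖ₑ :=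
    fun n => ((hw n).sub_const _).enorm
  have hmean : ∀ n, ‖∫ z, w n z ∂ν‖ₑ ≤ 2 * (R + t) := by
    intro n
    have h1 : ‖∫ z, w n z ∂ν‖ₑ * 2⁻¹ ≤ R + t := by
      calc ‖∫ z, w n z ∂ν‖ₑ * 2⁻¹ ≤ ‖∫ z, w n z ∂ν‖ₑ * ν {x | |u x| ≤ t} := by gcongr
        _ = ∫⁻ _ in {x | |u x| ≤ t}, ‖∫ z, w n z ∂ν‖ₑ ∂ν := (setLIntegral_const _ _).symm
        _ ≤ ∫⁻ x in {x | |u x| ≤ t}, (‖w n x - ∫ z, w n z ∂ν‖ₑ + t) ∂ν := by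
            refine setLIntegral_mono ((hmeas n).add_const _) fun x (hx : |u x| ≤ t) => ?_
            have h2 : ‖w n x‖ₑ ≤ t := by
              rw [Real.enorm_eq_ofReal_abs, ← ENNReal.ofReal_natCast t]
              exact ENNReal.ofReal_le_ofReal ((hwu n x).trans hx)
            calc ‖∫ z, w n z ∂ν‖ₑ = ‖w n x - (w n x - ∫ z, w n z ∂ν)‖ₑ := by rw [sub_sub_cancel]
              _ ≤ ‖w n x‖ₑ + ‖w n x - ∫ z, w n z ∂ν‖ₑ := enorm_sub_le
              _ ≤ _ := by rw [add_comm]; gcongr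
        _ ≤ ∫⁻ x, (‖w n x - ∫ z, w n z ∂ν‖ₑ + t) ∂ν := setLIntegral_le_lintegral _ _
        _ ≤ R + t := by
            rw [lintegral_add_right _ measurable_const, lintegral_const, measure_univ, mul_one]
            gcongr
            exact h n
    rw [← div_eq_mul_inv] at h1
    exact mul_comm (R + (t : ℝ≥0∞)) 2 ▸ (ENNReal.div_le_iff (by simp) (by simp)).1 h1
  have hint : Integrable u ν := by
    refine ⟨hu.aestronglyMeasurable, ?_⟩
    have h1 : ∫⁻ x, ‖u x‖ₑ ∂ν ≤ R + 2 * (R + t) := by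
      calc ∫⁻ x, ‖u x‖ₑ ∂ν = ∫⁻ x, liminf (fun n => ‖w n x‖ₑ) atTop ∂ν := by
            refine lintegral_congr fun x => ?_
            exact ((continuous_enorm.tendsto _).comp (hlim x)).liminf_eq.symm
        _ ≤ liminf (fun n => ∫⁻ x, ‖w n x‖ₑ ∂ν) atTop :=
            lintegral_liminf_le fun n => (hw n).enorm
        _ ≤ R + 2 * (R + t) := by
            refine (liminf_le_liminf (v := fun _ : ℕ => R + 2 * (R + t))
              (Eventually.of_forall fun n => ?_)).trans (by simp)
            calc ∫⁻ x, ‖w n x‖ₑ ∂ν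
                ≤ ∫⁻ x, (‖w n x - ∫ z, w n z ∂ν‖ₑ + ‖∫ z, w n z ∂ν‖ₑ) ∂ν := by
                  refine lintegral_mono fun x => ?_
                  simpa using enorm_add_le (w n x - ∫ z, w n z ∂ν) (∫ z, w n z ∂ν)
              _ ≤ R + 2 * (R + t) := by
                  rw [lintegral_add_right _ measurable_const, lintegral_const, measure_univ,
                    mul_one]
                  exact add_le_add (h n) (hmean n)
    refine h1.trans_lt (ENNReal.add_lt_top.2 ⟨hR.lt_top, ENNReal.mul_lt_top (by simp) ?_⟩)
    exact ENNReal.add_lt_top.2 ⟨hR.lt_top, by simp⟩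
  have hmlim : Tendsto (fun n => ∫ z, w n z ∂ν) atTop (𝓝 (∫ z, u z ∂ν)) :=
    tendsto_integral_of_dominated_convergence (fun x => |u x|)
      (fun n => (hw n).aestronglyMeasurable) hint.abs
      (fun n => Eventually.of_forall fun x => hwu n x) (Eventually.of_forall hlim)
  calc ∫⁻ x, ‖u x - ∫ z, u z ∂ν‖ₑ ∂ν
      = ∫⁻ x, liminf (fun n => ‖w n x - ∫ z, w n z ∂ν‖ₑ) atTop ∂ν := by
        refine lintegral_congr fun x => ?_
        exact ((continuous_enorm.tendsto _).comp ((hlim x).sub hmlim)).liminf_eq.symm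
    _ ≤ liminf (fun n => ∫⁻ x, ‖w n x - ∫ z, w n z ∂ν‖ₑ ∂ν) atTop := lintegral_liminf_le hmeas
    _ ≤ R := (liminf_le_liminf (v := fun _ : ℕ => R) (Eventually.of_forall h)).trans (by simp)

end Oscillation

/-! ### Equivalence of the Lipschitz and chain inequalities -/

section Equivalence

variable {X : Type*} [MetricSpace X] [MeasurableSpace X] [BorelSpace X]

theorem PoincareLip.le_of_abs_le {μ : Measure X} [μ.InnerRegularCompactLTTop] {p C Λ : ℝ}
    (h : PoincareLip μ p C Λ) (hfin : ∀ (x : X) (r : ℝ), μ (ball x r) ≠ ∞) (hp : 1 ≤ p)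
    (hΛ : 1 ≤ Λ) {u : X → ℝ} (hu : Measurable u) {M : ℝ} (hM : 0 ≤ M) (huM : ∀ x, |u x| ≤ M)
    {g : X → ℝ≥0∞} {ε : ℝ} (hε : 0 < ε) (hg : IsEpsUpperGradient ε u g) {x : X} {r : ℝ}
    (hr : 0 < r) (hgp : ∫⁻ y in ball x (Λ * r), g y ^ p ∂μ ≠ ∞) (hμ0 : μ (ball x r) ≠ 0) :
    ⨍⁻ y in ball x r, ‖u y - ⨍ z in ball x r, u z ∂μ‖ₑ ∂μ ≤
      ENNReal.ofReal (C * r) * (⨍⁻ y in ball x (Λ * r), g y ^ p ∂μ) ^ (1 / p) := by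
  have hp0 : 0 < p := one_pos.trans_le hp
  have hsub : ball x r ⊆ ball x (Λ * r) := ball_subset_ball (le_mul_of_one_le_left hr.le hΛ)
  have hμ0' : μ (ball x (Λ * r)) ≠ 0 := fun h0 => hμ0 (measure_mono_null hsub h0)
  -- `θ * Q` is the total error of replacing `u` by its approximation: one term from the energy, one
  -- from the `L^1` distance, counted twice because the mean moves too.
  let Q : ℝ≥0∞ := ENNReal.ofReal (C * r) * ((μ (ball x (Λ * r)))⁻¹) ^ (1 / p) +
    2 * (μ (ball x r))⁻¹
  have hQ : Q ≠ ∞ := by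
    refine ENNReal.add_ne_top.2 ⟨ENNReal.mul_ne_top ENNReal.ofReal_ne_top ?_, ?_⟩
    · exact ENNReal.rpow_ne_top_of_nonneg (by positivity) (ENNReal.inv_ne_top.2 hμ0')
    · exact ENNReal.mul_ne_top (by simp) (ENNReal.inv_ne_top.2 hμ0)
  refine ENNReal.le_of_forall_pos_le_add fun κ hκ _ => ?_
  obtain ⟨θ, hθ0, hθ⟩ := ENNReal.exists_nnreal_pos_mul_lt hQ
    (ENNReal.coe_ne_zero.2 hκ.ne')
  obtain ⟨v, hvL, hvM, hvu, hvl⟩ := exists_lipschitz_approx μ measurableSet_ball (hfin x (Λ * r))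
    hp hM huM hε hg hgp (ENNReal.coe_ne_zero.2 hθ0.ne')
  have hv : Measurable v := hvL.choose_spec.continuous.measurable
  have hv2 := h v hvL x r hr
  simp_rw [← Real.enorm_eq_ofReal_abs] at hv2 hvu
  let ν : Measure X := (μ.restrict (ball x r) Set.univ)⁻¹ • μ.restrict (ball x r)
  have hν : ν Set.univ = 1 := by
    simp only [ν, Measure.smul_apply, smul_eq_mul, Measure.restrict_apply_univ]
    exact ENNReal.inv_mul_cancel hμ0 (hfin x r)
  have : IsFiniteMeasure ν := ⟨by rw [hν]; simp⟩
  have hint : ∀ w : X → ℝ, Measurable w → (∀ y, |w y| ≤ M) → Integrable w ν := fun w hw hwM =>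
    Integrable.of_bound hw.aestronglyMeasurable M (Eventually.of_forall hwM)
  have key := lintegral_sub_integral_le hν.le (hint u hu huM) (hint v hv hvM)
  have hvu' : ∫⁻ y, ‖v y - u y‖ₑ ∂ν ≤ (μ (ball x r))⁻¹ * θ := by
    simp only [ν, lintegral_smul_measure, smul_eq_mul, Measure.restrict_apply_univ]
    gcongr
    exact (lintegral_mono_set hsub).trans hvu
  have havg : ∀ f : X → ℝ≥0∞, (⨍⁻ y in ball x (Λ * r), f y ∂μ) ^ (1 / p) =
      ((μ (ball x (Λ * r)))⁻¹) ^ (1 / p) * (∫⁻ y in ball x (Λ * r), f y ∂μ) ^ (1 / p) := by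
    intro f
    rw [setLAverage_eq, ENNReal.div_eq_inv_mul, ENNReal.mul_rpow_of_nonneg _ _ (by positivity)]
  calc ⨍⁻ y in ball x r, ‖u y - ⨍ z in ball x r, u z ∂μ‖ₑ ∂μ
      ≤ ⨍⁻ y in ball x r, ‖v y - ⨍ z in ball x r, v z ∂μ‖ₑ ∂μ + 2 * ∫⁻ y, ‖v y - u y‖ₑ ∂ν := key
    _ ≤ ENNReal.ofReal (C * r) * (⨍⁻ y in ball x (Λ * r), lip v y ^ p ∂μ) ^ (1 / p) +
          2 * ((μ (ball x r))⁻¹ * θ) := by gcongr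
    _ ≤ ENNReal.ofReal (C * r) * (((μ (ball x (Λ * r)))⁻¹) ^ (1 / p) *
          ((∫⁻ y in ball x (Λ * r), g y ^ p ∂μ) ^ (1 / p) + θ)) +
          2 * ((μ (ball x r))⁻¹ * θ) := by
        rw [havg]
        gcongr
    _ = ENNReal.ofReal (C * r) * (⨍⁻ y in ball x (Λ * r), g y ^ p ∂μ) ^ (1 / p) + θ * Q := by
        rw [havg]
        simp only [Q]
        ring
    _ ≤ _ := by gcongr

theorem PoincareLip.poincareChain {μ : Measure X} [μ.InnerRegularCompactLTTop] {p C Λ : ℝ}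
    (h : PoincareLip μ p C Λ) (hfin : ∀ (x : X) (r : ℝ), μ (ball x r) ≠ ∞) (hp : 1 ≤ p)
    (hC : 1 ≤ C) (hΛ : 1 ≤ Λ) : PoincareChain μ p C Λ := by
  rintro u g hu ⟨ε, hε, hg⟩ x r hr
  have hp0 : 0 < p := one_pos.trans_le hp
  simp_rw [← Real.enorm_eq_ofReal_abs]
  rcases eq_or_ne (μ (ball x r)) 0 with hμ0 | hμ0
  · rw [Measure.restrict_eq_zero.2 hμ0]
    simp
  by_cases hgp : ∫⁻ y in ball x (Λ * r), g y ^ p ∂μ = ∞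
  -- Infinite energy makes the right-hand side infinite, as `C * r > 0` and the ball has finite
  -- measure.
  · rw [setLAverage_eq, setLAverage_eq, hgp, ENNReal.top_div_of_ne_top (hfin _ _),
      ENNReal.top_rpow_of_pos (by positivity), ENNReal.mul_top]
    · exact le_top
    · simp only [ne_eq, ENNReal.ofReal_eq_zero, not_le]
      positivity
  let ν : Measure X := (μ.restrict (ball x r) Set.univ)⁻¹ • μ.restrict (ball x r)
  have : IsProbabilityMeasure ν := ⟨by
    simp only [ν, Measure.smul_apply, smul_eq_mul, Measure.restrict_apply_univ]
    exact ENNReal.inv_mul_cancel hμ0 (hfin x r)⟩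
  refine lintegral_sub_integral_le_of_clamp (ν := ν) hu fun n => ?_
  exact h.le_of_abs_le hfin hp hΛ (measurable_const.max (hu.min measurable_const))
    (Nat.cast_nonneg n) (fun y => abs_clamp_le (Nat.cast_nonneg n) _) hε
    (hg.comp (lipschitzWith_clamp n)) hr hgp hμ0

theorem PoincareChain.poincareLip {μ : Measure X} {p C Λ : ℝ} (h : PoincareChain μ p C Λ)
    (hp : 1 ≤ p) : PoincareLip μ p C Λ := by
  rintro u ⟨K, hu⟩ x r hr
  have hp0 : 0 < p := one_pos.trans_le hp
  let ν : Measure X := (μ.restrict (ball x (Λ * r)) Set.univ)⁻¹ • μ.restrict (ball x (Λ * r))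
  have hν : ν Set.univ ≤ 1 := by
    simp only [ν, Measure.smul_apply, smul_eq_mul]
    exact ENNReal.inv_mul_le_one _
  have hlim : Tendsto (fun n : ℕ => ∫⁻ y, slopeAt (1 / ((n : ℝ) + 1)) u y ^ p ∂ν) atTop
      (𝓝 (∫⁻ y, lip u y ^ p ∂ν)) := by
    refine tendsto_lintegral_of_dominated_convergence (fun _ => (K : ℝ≥0∞) ^ p)
      (fun n => (measurable_slopeAt hu.continuous _).pow_const p) (fun n => ?_) ?_ ?_
    · refine Eventually.of_forall fun y => ?_
      exact ENNReal.rpow_le_rpow (slopeAt_le_of_lipschitzWith hu _ y) hp0.le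
    · rw [lintegral_const]
      exact ENNReal.mul_ne_top (ENNReal.rpow_ne_top_of_nonneg hp0.le ENNReal.coe_ne_top)
        (hν.trans_lt ENNReal.one_lt_top).ne
    · refine Eventually.of_forall fun y => ?_
      exact (ENNReal.continuous_rpow_const.tendsto _).comp (tendsto_slopeAt_lip
        (fun n => by positivity) tendsto_one_div_add_atTop_nhds_zero_nat u y)
  refine ge_of_tendsto (ENNReal.Tendsto.const_mul
    ((ENNReal.continuous_rpow_const.tendsto _).comp hlim) (Or.inr ENNReal.ofReal_ne_top))
    (Eventually.of_forall fun n => ?_)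
  have hn : (0 : ℝ) < 1 / ((n : ℝ) + 1) := by positivity
  exact h u _ hu.continuous.measurable
    ⟨_, half_pos hn, isEpsUpperGradient_slopeAt hu.continuous (half_lt_self hn)⟩ x r hr

end Equivalence

/-! ### Passage from dense subsets -/

section Density

/-- Slopes already agree at each scale: a bound on difference quotients is a closed condition in
`y`, and the image is dense in the open ball. -/
theorem lip_comp_of_isometry_of_denseRange {X Y : Type*} [MetricSpace X] [MetricSpace Y] {i : X → Y}
    (hi : Isometry i) (hd : DenseRange i) {v : Y → ℝ} (hv : Continuous v) (x : X) :
    lip (fun y => v (i y)) x = lip v (i x) := by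
  refine iInf_congr fun ε => iInf_congr fun _ => le_antisymm ?_ ?_
  · refine slopeAt_le_of_forall_edist_le fun y hy => ?_
    rw [← hi.edist_eq]
    exact edist_le_slopeAt_mul v (by rwa [mem_ball, hi.dist_eq])
  · refine slopeAt_le_of_forall_edist_le fun y hy => ?_
    set c := slopeAt ε (fun y => v (i y)) x
    -- Closedness of the condition needs multiplication by `c` to be continuous, hence `c` finite.
    rcases eq_or_ne c ∞ with hc | hc
    · rcases eq_or_ne y (i x) with rfl | hne
      · simp
      · rw [hc, ENNReal.top_mul (by simpa using hne)]
        exact le_top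
    have hcl : y ∈ closure (ball (i x) ε ∩ Set.range i) :=
      hd.open_subset_closure_inter isOpen_ball hy
    have hclosed : IsClosed {z | edist (v z) (v (i x)) ≤ c * edist z (i x)} :=
      isClosed_le (hv.edist continuous_const)
        ((ENNReal.continuous_const_mul hc).comp (continuous_id.edist continuous_const))
    refine closure_minimal ?_ hclosed hcl
    rintro _ ⟨hz, ⟨z, rfl⟩⟩
    rw [Set.mem_ofPred_eq, hi.edist_eq]
    exact edist_le_slopeAt_mul (fun y => v (i y)) (by rwa [mem_ball, hi.dist_eq] at hz)

/-- The Poincaré inequality on balls with centres in a dense set implies it on all balls. -/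
theorem PoincareCouple.of_dense {Y : Type*} [MetricSpace Y] [MeasurableSpace Y] [BorelSpace Y]
    {ν : Measure Y} (hfin : ∀ (y : Y) (r : ℝ), ν (ball y r) ≠ ∞) {D : Set Y} (hD : Dense D)
    {p C Λ : ℝ} (hp : 0 < p) (hC : 0 ≤ C) (hΛ : 1 ≤ Λ) {v : Y → ℝ} {K : NNReal}
    (hv : LipschitzWith K v) {g : Y → ℝ≥0∞}
    (h : ∀ x ∈ D, ∀ r : ℝ, 0 < r →
      ⨍⁻ y in ball x r, ENNReal.ofReal |v y - ⨍ z in ball x r, v z ∂ν| ∂ν ≤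
        ENNReal.ofReal (C * r) * (⨍⁻ y in ball x (Λ * r), g y ^ p ∂ν) ^ (1 / p)) :
    PoincareCouple ν p C Λ v g := by
  intro y r hr
  simp_rw [← Real.enorm_eq_ofReal_abs] at h ⊢
  rcases eq_or_ne (ν (ball y r)) 0 with h0 | h0
  · rw [Measure.restrict_eq_zero.2 h0]
    simp
  -- Shrinking the radius by the bound on the displacement of the centre keeps the approximating
  -- balls inside; `n + 2` makes the radius positive already at `n = 0`.
  let δ : ℕ → ℝ := fun n => r / (n + 2)
  have hδ : ∀ n, 0 < δ n := fun n => by positivity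
  have hδr : ∀ n, δ n < r := fun n =>
    div_lt_self hr (by have : (0 : ℝ) ≤ n := n.cast_nonneg; linarith)
  have hδ0 : Tendsto δ atTop (𝓝 0) :=
    tendsto_const_nhds.div_atTop (tendsto_atTop_add_const_right _ _ tendsto_natCast_atTop_atTop)
  choose x hxD hx using fun n => hD.exists_dist_lt y (hδ n)
  -- the approximating balls exhaust the given ones
  have hsub : ∀ t : ℝ, 1 ≤ t → ∀ n, ball (x n) (t * (r - δ n)) ⊆ ball y (t * r) := by
    intro t ht n
    apply ball_subset_ball'
    have h1 := hx n
    rw [dist_comm] at h1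
    have h2 := le_mul_of_one_le_left (hδ n).le ht
    rw [mul_sub]; linarith
  have hexh : ∀ t : ℝ, ∀ z ∈ ball y (t * r), ∀ᶠ n in atTop, z ∈ ball (x n) (t * (r - δ n)) := by
    intro t z hz
    have h1 : Tendsto (fun n => t * (r - δ n) - δ n) atTop (𝓝 (t * (r - 0) - 0)) :=
      ((tendsto_const_nhds.sub hδ0).const_mul t).sub hδ0
    rw [sub_zero, sub_zero] at h1
    filter_upwards [h1.eventually (lt_mem_nhds (mem_ball.1 hz))] with n hn
    have := dist_triangle z y (x n)
    rw [mem_ball]; linarith [hx n]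
  have hind : ∀ t : ℝ, 1 ≤ t → ∀ {E : Type} [Zero E] [TopologicalSpace E] (f : Y → E) (z : Y),
      Tendsto (fun n => (ball (x n) (t * (r - δ n))).indicator f z) atTop
        (𝓝 ((ball y (t * r)).indicator f z)) := by
    intro t ht E _ _ f z
    refine tendsto_const_nhds.congr' ?_
    by_cases hz : z ∈ ball y (t * r)
    · filter_upwards [hexh t z hz] with n hn
      rw [Set.indicator_of_mem hz, Set.indicator_of_mem hn]
    · refine Eventually.of_forall fun n => ?_
      beta_reduce
      rw [Set.indicator_of_notMem hz, Set.indicator_of_notMem fun hn => hz (hsub t ht n hn)]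
  have hmeas : ∀ t : ℝ, 1 ≤ t → Tendsto (fun n => ν (ball (x n) (t * (r - δ n)))) atTop
      (𝓝 (ν (ball y (t * r)))) := by
    intro t ht
    simp_rw [← lintegral_indicator_one measurableSet_ball]
    refine tendsto_lintegral_of_dominated_convergence ((ball y (t * r)).indicator 1)
      (fun n => measurable_one.indicator measurableSet_ball) (fun n => Eventually.of_forall ?_) ?_
      (Eventually.of_forall fun z => hind t ht _ z)
    · exact fun z => Set.indicator_le_indicator_of_subset (hsub t ht n) (fun _ => zero_le) z
    · rw [lintegral_indicator_one measurableSet_ball]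
      exact hfin _ _
  have hsub1 : ∀ n, ball (x n) (r - δ n) ⊆ ball y r := by simpa using hsub 1 le_rfl
  have hmeas1 : Tendsto (fun n => ν (ball (x n) (r - δ n))) atTop (𝓝 (ν (ball y r))) := by
    simpa using hmeas 1 le_rfl
  have hvint : IntegrableOn v (ball y r) ν := by
    refine Measure.integrableOn_of_bounded (M := |v y| + K * r) (hfin y r)
      hv.continuous.measurable.aestronglyMeasurable ?_
    refine (ae_restrict_iff' measurableSet_ball).2 (Eventually.of_forall fun z hz => ?_)
    have h1 := hv.dist_le_mul z y
    have h2 : (K : ℝ) * dist z y ≤ K * r := by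
      gcongr
      exact (mem_ball.1 hz).le
    rw [Real.dist_eq] at h1
    rw [Real.norm_eq_abs]
    linarith [abs_sub_abs_le_abs_sub (v z) (v y)]
  have hI : Tendsto (fun n => ∫ z in ball (x n) (r - δ n), v z ∂ν) atTop
      (𝓝 (∫ z in ball y r, v z ∂ν)) := by
    simp_rw [← integral_indicator measurableSet_ball]
    refine tendsto_integral_of_dominated_convergence ((ball y r).indicator fun z => ‖v z‖)
      (fun n => (hv.continuous.measurable.indicator measurableSet_ball).aestronglyMeasurable)
      ((integrable_indicator_iff measurableSet_ball).2 hvint.norm)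
      (fun n => Eventually.of_forall fun z => ?_) (Eventually.of_forall fun z => ?_)
    · rw [norm_indicator_eq_indicator_norm]
      exact Set.indicator_le_indicator_of_subset (hsub1 n) (fun _ => norm_nonneg _) z
    · simpa using hind 1 le_rfl v z
  have havg : Tendsto (fun n => ⨍ z in ball (x n) (r - δ n), v z ∂ν) atTop
      (𝓝 (⨍ z in ball y r, v z ∂ν)) := by
    simp_rw [setAverage_eq]
    refine Tendsto.smul (Tendsto.inv₀ ?_ ?_) hI
    · exact (ENNReal.tendsto_toReal (hfin y r)).comp hmeas1
    · exact (ENNReal.toReal_pos h0 (hfin y r)).ne'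
  let f : ℕ → Y → ℝ≥0∞ := fun n => (ball (x n) (r - δ n)).indicator fun z =>
    ‖v z - ⨍ z in ball (x n) (r - δ n), v z ∂ν‖ₑ
  have hf : ∀ z, Tendsto (fun n => f n z) atTop
      (𝓝 ((ball y r).indicator (fun z => ‖v z - ⨍ z in ball y r, v z ∂ν‖ₑ) z)) := by
    intro z
    by_cases hz : z ∈ ball y r
    · rw [Set.indicator_of_mem hz]
      refine ((continuous_enorm.tendsto _).comp (tendsto_const_nhds.sub havg)).congr' ?_
      have := hexh 1 z (by simpa using hz)
      simp only [one_mul] at this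
      filter_upwards [this] with n hn
      simp only [f]
      rw [Set.indicator_of_mem hn]
      rfl
    · refine tendsto_const_nhds.congr fun n => ?_
      simp only [f]
      rw [Set.indicator_of_notMem hz, Set.indicator_of_notMem fun hn => hz (hsub1 n hn)]
  have hfm : ∀ n, Measurable (f n) := fun n =>
    ((hv.continuous.measurable.sub_const _).enorm).indicator measurableSet_ball
  -- Everything is enlarged to the limit balls except the measure in the denominator, which must
  -- stay small-ball and converges by `hmeas`.
  have hbound : ∀ n, ∫⁻ z, f n z ∂ν ≤ ENNReal.ofReal (C * r) * ν (ball y r) *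
      ((∫⁻ z in ball y (Λ * r), g z ^ p ∂ν) / ν (ball (x n) (Λ * (r - δ n)))) ^ (1 / p) := by
    intro n
    have h1 := h (x n) (hxD n) (r - δ n) (sub_pos.2 (hδr n))
    simp only [f]
    rw [lintegral_indicator measurableSet_ball]
    rw [setLAverage_eq, setLAverage_eq] at h1
    rcases eq_or_ne (ν (ball (x n) (r - δ n))) 0 with hz | hz
    · rw [Measure.restrict_eq_zero.2 hz]
      simp
    rw [ENNReal.div_le_iff hz (hfin _ _)] at h1
    refine h1.trans ?_
    rw [mul_right_comm]
    gcongr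
    · linarith [hδ n]
    · exact hsub1 n
    · exact hsub Λ hΛ n
  rw [setLAverage_eq, setLAverage_eq, ENNReal.div_le_iff h0 (hfin _ _), mul_right_comm]
  have hlim := ENNReal.Tendsto.const_mul (a := ENNReal.ofReal (C * r) * ν (ball y r))
    ((ENNReal.continuous_rpow_const (y := 1 / p).tendsto _).comp
      (ENNReal.Tendsto.const_div (a := ∫⁻ z in ball y (Λ * r), g z ^ p ∂ν) (hmeas Λ hΛ)
        (Or.inl (hfin _ _)))) (Or.inr (ENNReal.mul_ne_top ENNReal.ofReal_ne_top (hfin y r)))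
  calc ∫⁻ z in ball y r, ‖v z - ⨍ z in ball y r, v z ∂ν‖ₑ ∂ν
      = ∫⁻ z, liminf (fun n => f n z) atTop ∂ν := by
        rw [← lintegral_indicator measurableSet_ball]
        exact lintegral_congr fun z => (hf z).liminf_eq.symm
    _ ≤ liminf (fun n => ∫⁻ z, f n z ∂ν) atTop := lintegral_liminf_le hfm
    _ ≤ _ := (liminf_le_liminf (Eventually.of_forall hbound)).trans hlim.liminf_eq.le

end Density

/-! ### Transfer to the metric completion -/

section Completion

variable {X : Type*} [MetricSpace X]

theorem isometry_coe_completion : Isometry (fun x : X => (x : UniformSpace.Completion X)) :=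
  UniformSpace.Completion.coe_isometry

theorem preimage_coe_ball (x : X) (r : ℝ) :
    (fun x : X => (x : UniformSpace.Completion X)) ⁻¹' ball (x : UniformSpace.Completion X) r =
      ball x r :=
  isometry_coe_completion.preimage_ball x r

variable [MeasurableSpace X] [BorelSpace X]

theorem measurable_coe_completion :
    Measurable (fun x : X => (x : UniformSpace.Completion X)) :=
  (UniformSpace.Completion.continuous_coe X).measurable

theorem completionMeasure_ball (μ : Measure X) (x : X) (r : ℝ) :
    completionMeasure μ (ball (x : UniformSpace.Completion X) r) = μ (ball x r) := by
  rw [completionMeasure_apply μ measurableSet_ball, preimage_coe_ball]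

theorem completionMeasure_ball_ne_top {μ : Measure X} (hfin : ∀ (x : X) (r : ℝ), μ (ball x r) ≠ ∞)
    (y : UniformSpace.Completion X) (r : ℝ) : completionMeasure μ (ball y r) ≠ ∞ := by
  obtain ⟨x, hx⟩ :=
    (UniformSpace.Completion.denseRange_coe (α := X)).exists_dist_lt y one_pos
  refine ne_top_of_le_ne_top ?_ (measure_mono (ball_subset_ball' (x := y) (y := x) (ε₁ := r)
    (ε₂ := r + 1) (by gcongr)))
  rw [completionMeasure_ball]
  exact hfin x _

theorem setLAverage_completionMeasure (μ : Measure X) (x : X) (r : ℝ)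
    {f : UniformSpace.Completion X → ℝ≥0∞} (hf : Measurable f) :
    ⨍⁻ y in ball (x : UniformSpace.Completion X) r, f y ∂completionMeasure μ =
      ⨍⁻ y in ball x r, f y ∂μ := by
  rw [setLAverage_eq, setLAverage_eq, completionMeasure_ball]
  unfold completionMeasure
  rw [setLIntegral_map measurableSet_ball hf measurable_coe_completion, preimage_coe_ball]

theorem setAverage_completionMeasure (μ : Measure X) (x : X) (r : ℝ)
    {f : UniformSpace.Completion X → ℝ} (hf : Measurable f) :
    ⨍ y in ball (x : UniformSpace.Completion X) r, f y ∂completionMeasure μ =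
      ⨍ y in ball x r, f y ∂μ := by
  rw [setAverage_eq, setAverage_eq, measureReal_def, measureReal_def, completionMeasure_ball]
  unfold completionMeasure
  rw [setIntegral_map measurableSet_ball hf.aestronglyMeasurable
    measurable_coe_completion.aemeasurable, preimage_coe_ball]

theorem poincare_completionMeasure_iff (μ : Measure X) {p C Λ : ℝ}
    {v : UniformSpace.Completion X → ℝ} (hv : Continuous v) (x : X) (r : ℝ) :
    (⨍⁻ y in ball (x : UniformSpace.Completion X) r, ENNReal.ofReal
        |v y - ⨍ z in ball (x : UniformSpace.Completion X) r, v z ∂completionMeasure μ|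
          ∂completionMeasure μ ≤
      ENNReal.ofReal (C * r) * (⨍⁻ y in ball (x : UniformSpace.Completion X) (Λ * r),
        lip v y ^ p ∂completionMeasure μ) ^ (1 / p)) ↔
    (⨍⁻ y in ball x r, ENNReal.ofReal |v y - ⨍ z in ball x r, v z ∂μ| ∂μ ≤
      ENNReal.ofReal (C * r) *
        (⨍⁻ y in ball x (Λ * r), lip (fun z : X => v z) y ^ p ∂μ) ^ (1 / p)) := by
  rw [setAverage_completionMeasure μ x r hv.measurable,
    setLAverage_completionMeasure μ x r
      ((hv.measurable.sub_const _).abs.ennreal_ofReal),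
    setLAverage_completionMeasure μ x (Λ * r) ((measurable_lip hv).pow_const p)]
  simp_rw [lip_comp_of_isometry_of_denseRange isometry_coe_completion
    UniformSpace.Completion.denseRange_coe hv]

theorem poincareLip_completionMeasure_iff {μ : Measure X}
    (hfin : ∀ (x : X) (r : ℝ), μ (ball x r) ≠ ∞) {p C Λ : ℝ} (hp : 0 < p) (hC : 0 ≤ C)
    (hΛ : 1 ≤ Λ) : PoincareLip μ p C Λ ↔ PoincareLip (completionMeasure μ) p C Λ := by
  constructor
  · rintro h v ⟨K, hv⟩
    refine PoincareCouple.of_dense (completionMeasure_ball_ne_top hfin)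
      (UniformSpace.Completion.denseRange_coe (α := X)) hp hC hΛ hv ?_
    rintro _ ⟨x, rfl⟩ r hr
    refine (poincare_completionMeasure_iff μ hv.continuous x r).2 ?_
    exact h (fun z : X => v z) ⟨K * 1, hv.comp isometry_coe_completion.lipschitz⟩ x r hr
  · rintro h u ⟨K, hu⟩ x r hr
    have hue : ∀ z : X, UniformSpace.Completion.extension u z = u z :=
      UniformSpace.Completion.extension_coe hu.uniformContinuous
    have hv : LipschitzWith K (UniformSpace.Completion.extension u) := hu.completion_extension
    have := (poincare_completionMeasure_iff μ hv.continuous x r).1 (h _ ⟨K, hv⟩ (x : _) r hr)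
    simpa only [hue] using this

end Completion

end ChainPoincare

theorem mainTheorem6 {X : Type*} [MetricSpace X] [TopologicalSpace.SeparableSpace X]
    [MeasurableSpace X] [BorelSpace X] (μ : Measure X) [μ.Regular] (hμ : μ ≠ 0)
    (hfin : ∀ s : Set X, Bornology.IsBounded s → μ s < ∞) (p : ℝ) (hp : 1 ≤ p)
    (C Λ : ℝ) (hC : 1 ≤ C) (hΛ : 1 ≤ Λ) :
    (ChainPoincare.PoincareLip μ p C Λ ↔ ChainPoincare.PoincareChain μ p C Λ) ∧
      (ChainPoincare.PoincareLip μ p C Λ ↔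
        ChainPoincare.PoincareLip (ChainPoincare.completionMeasure μ) p C Λ) := by
  have hball : ∀ (x : X) (r : ℝ), μ (ball x r) ≠ ∞ := fun x r => (hfin _ isBounded_ball).ne
  exact ⟨⟨fun h => h.poincareChain hball hp hC hΛ, fun h => h.poincareLip hp⟩,
    ChainPoincare.poincareLip_completionMeasure_iff hball (one_pos.trans_le hp)
      (zero_le_one.trans hC) hΛ⟩
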